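/- Let $G$ be a finite simple bipartite graph whose vertex set is partitioned into two parts $U$ and $W$ such that every edge joins $U$ to $W$, every vertex of $U$ has degree $d_v$ and every vertex of $W$ has degree $d_c$. Suppose that $G$ contains a cycle and that its girth $g$ (the length of a shortest cycle) is at least $6$. Let $N_k$ be the number of cycles of length $k$ in $G$, counted as subgraphs, i.e. irrespective of starting vertex and direction. Let $\Psi_k$ be the number of closed walks $v_1,v_2,\dots,v_{k+1}=v_1$ of length $k$ in $G$ that are not cycles but for which the subgraph formed by the traversed edges contains a cycle; here closed walks that differ in starting vertex or direction are counted separately. Then $$ \begin{aligned} \frac{\Psi_{g+4}}{2(g+4)} ={}& N_{g+2}\Big[\tfrac{g+2}{2}(d_v+d_c)-(g+2)\Big]\\ &+N_g\Big[\tfrac g2(d_v-2)(d_c-1)+\tfrac g2(d_c-2)(d_v-1)\Big]\\ &+N_g\Big(\Big[\tbinom{g/2}{2}+\tfrac g2\Big](d_v-2)^2+\Big[\tbinom{g/2}{2}+\tfrac g2\Big](d_c-2)^2+\big(\tfrac g2\big)^2(d_v-2)(d_c-2)\Big)\\ &+N_g\Big(\tbinom g2+2g+(g+2)\big(\tfrac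 g2(d_v-2)+\tfrac g2(d_c-2)\big)\Big). \end{aligned} $$ -/

import Mathlib

namespace SimpleGraph

variable {V : Type*} (G : SimpleGraph V)

/-- A closed walk with cycle: it is not itself a cycle, but the graph formed by the edges it
traverses contains a cycle. (Vertices of `V` not on the walk are isolated in `fromEdgeSet`, so they
do not affect the existence of a cycle.) -/
def Walk.IsClosedWalkWithCycle {G : SimpleGraph V} {v : V} (p : G.Walk v v) : Prop :=
  ¬ p.IsCycle ∧ ¬ (SimpleGraph.fromEdgeSet p.edgeSet).IsAcyclic

/-- The number `N_k` of cycles of length `k`, as subgraphs: a cycle is identified with its set of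
edges, so that starting vertex and direction are disregarded. -/
noncomputable def numCycles (k : ℕ) : ℕ :=
  Set.ncard {S : Set (Sym2 V) |
    ∃ (v : V) (c : G.Walk v v), c.IsCycle ∧ c.length = k ∧ S = c.edgeSet}

/-- The number `Ψ_k` of closed walks with cycle of length `k`; closed walks that differ in starting
vertex or direction are counted separately. -/
noncomputable def numClosedWalksWithCycle (k : ℕ) : ℕ :=
  Set.ncard {w : Σ v : V, G.Walk v v | w.2.length = k ∧ w.2.IsClosedWalkWithCycle}

/-- `G` is bipartite with parts `U` and `W` that partition the vertex set, every vertex of `U` has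
degree `dv` and every vertex of `W` has degree `dc`. -/
structure IsBiregularWith [G.LocallyFinite] (U W : Set V) (dv dc : ℕ) : Prop where
  isBipartiteWith : G.IsBipartiteWith U W
  union_eq_univ : U ∪ W = Set.univ
  degree_left : ∀ u ∈ U, G.degree u = dv
  degree_right : ∀ w ∈ W, G.degree w = dc

end SimpleGraph

/-!
Cancelling backtracking steps turns a closed walk into a unique reduced one, as if the walk were
lifted to the universal cover. That cover is a biregular tree, so the number of walks of length `n`
with a given reduction of length `l` depends only on `n`, `l` and the degrees.

Below twice the girth, the edges of a closed walk contain a cycle exactly when its reduction is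
nontrivial: a walk with trivial reduction uses each of its edges at least twice. In the same range a
reduced closed walk is either a cycle or a shorter reduced closed walk with one step attached at
both ends. This expresses the numbers of reduced closed walks of lengths `g`, `g + 2` and `g + 4`
through the numbers of cycles, and the claim follows by summing over both parts and discarding the
closed walks that are cycles themselves.
-/

namespace ClosedWalk

open Finset SimpleGraph

variable {V : Type*} {G : SimpleGraph V} {u v w : V}

/-! ### Reduced walks -/

/-- A walk is reduced if it never backtracks, that is, if consecutive edges are distinct. No
condition is imposed on the last and the first edge of a closed walk. -/
def IsReduced (p : G.Walk u v) : Prop := p.edges.IsChain (· ≠ ·)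

@[simp]
lemma isReduced_nil : IsReduced (.nil : G.Walk u u) := by simp [IsReduced]

lemma isReduced_cons_iff {h : G.Adj u w} {p : G.Walk w v} :
    IsReduced (.cons h p) ↔ IsReduced p ∧ (p.Nil ∨ p.snd ≠ u) := by
  cases p with
  | nil => simp [IsReduced]
  | @cons _ x _ h' q =>
    have : s(u, w) = s(w, x) ↔ x = u := by
      rw [Sym2.eq_swap, Sym2.congr_right, eq_comm]
    simp [IsReduced, List.isChain_cons_cons, this, and_comm]

lemma isReduced_append_iff {p : G.Walk u v} {q : G.Walk v w} :
    IsReduced (p.append q) ↔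
      IsReduced p ∧ IsReduced q ∧ (p.Nil ∨ q.Nil ∨ q.snd ≠ p.penultimate) := by
  induction p with
  | nil => simp
  | cons h p ih =>
    rw [Walk.cons_append, isReduced_cons_iff, ih, isReduced_cons_iff]
    cases p with
    | nil => simp
    | cons h' p =>
      simp only [Walk.cons_append, Walk.snd_cons, Walk.not_nil_cons, Walk.penultimate_cons_cons]
      tauto

lemma isReduced_cons_concat_iff {h : G.Adj v w} {q : G.Walk w w} (hq : ¬ q.Nil) :
    IsReduced (.cons h (q.concat h.symm)) ↔ IsReduced q ∧ v ≠ q.snd ∧ v ≠ q.penultimate := by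
  have hnil : ¬ (q.append (.cons h.symm .nil)).Nil := fun H => hq (Walk.nil_append_iff.1 H).1
  have hsnd : (q.append (.cons h.symm .nil)).snd = q.snd := by
    cases q with
    | nil => simp at hq
    | cons => simp
  rw [isReduced_cons_iff, Walk.concat_eq_append, isReduced_append_iff, hsnd]
  simp only [hq, hnil, isReduced_cons_iff, isReduced_nil, Walk.nil_nil, Walk.not_nil_cons,
    Walk.snd_cons, false_or, true_and, true_or]
  tauto

lemma IsReduced.of_cons {h : G.Adj u w} {p : G.Walk w v} (hp : IsReduced (.cons h p)) :
    IsReduced p :=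
  (isReduced_cons_iff.1 hp).1

lemma IsReduced.of_append_left {p : G.Walk u v} {q : G.Walk v w} (h : IsReduced (p.append q)) :
    IsReduced p :=
  (isReduced_append_iff.1 h).1

lemma IsReduced.of_append_right {p : G.Walk u v} {q : G.Walk v w} (h : IsReduced (p.append q)) :
    IsReduced q :=
  (isReduced_append_iff.1 h).2.1

lemma isReduced_of_isCycle {p : G.Walk v v} (hp : p.IsCycle) : IsReduced p :=
  List.Pairwise.isChain hp.isTrail.edges_nodup

lemma IsReduced.isCycle_cons_takeUntil [DecidableEq V] {h : G.Adj u w} {p : G.Walk w v}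
    (hr : IsReduced (.cons h p)) (hp : p.IsPath) (hu : u ∈ p.support) :
    (Walk.cons h (p.takeUntil u hu)).IsCycle := by
  rw [Walk.cons_isCycle_iff]
  refine ⟨hp.takeUntil hu, fun he => ?_⟩
  have hsnd : u = p.snd := by
    rw [← Walk.snd_takeUntil h.ne]
    exact (hp.takeUntil hu).eq_snd_of_mem_edges (Sym2.eq_swap ▸ he)
  obtain hnil | hne := (isReduced_cons_iff.1 hr).2
  · rw [Walk.nil_iff_support_eq.1 hnil] at hu
    exact h.ne (List.mem_singleton.1 hu)
  · exact hne hsnd.symm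

lemma IsReduced.exists_isCycle_isSubwalk : ∀ {u v : V} {p : G.Walk u v}, IsReduced p →
    ¬ p.IsPath → ∃ (x : V) (c : G.Walk x x), c.IsCycle ∧ c.IsSubwalk p
  | _, _, .nil, _, h => absurd Walk.IsPath.nil h
  | u, _, .cons h p, hr, hnp => by
    classical
    by_cases hp : p.IsPath
    · have hu : u ∈ p.support := by
        by_contra hu
        exact hnp (hp.cons hu)
      refine ⟨u, _, hr.isCycle_cons_takeUntil hp hu, .nil, p.dropUntil u hu, ?_⟩
      simp
    · obtain ⟨x, c, hc, hcp⟩ := hr.of_cons.exists_isCycle_isSubwalk hp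
      exact ⟨x, c, hc, hcp.cons h⟩

lemma IsReduced.egirth_le_length {p : G.Walk v v} (hp : IsReduced p) (hn : ¬ p.Nil) :
    G.egirth ≤ p.length := by
  obtain ⟨x, c, hc, hcp⟩ := hp.exists_isCycle_isSubwalk fun h => hn (Walk.isPath_iff_nil.1 h)
  exact (SimpleGraph.egirth_le_length hc).trans (mod_cast Walk.length_le_of_isSubwalk hcp)

lemma penultimate_append_of_not_nil (p : G.Walk u v) {q : G.Walk v w} (hq : ¬ q.Nil) :
    (p.append q).penultimate = q.penultimate := by
  induction p with
  | nil => rfl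
  | cons h p ih =>
    rw [Walk.cons_append, Walk.penultimate_cons_of_not_nil, ih hq]
    exact fun H => hq (Walk.nil_append_iff.1 H).2

/-- If the walk were not a cycle, it would contain a shorter cycle, and what remains of the walk
would close up to a reduced closed walk, because the first and the last edge differ. Each of the two
pieces is at least as long as the girth. -/
lemma IsReduced.isCycle_of_length_lt {p : G.Walk v v} (hp : IsReduced p) (hn : ¬ p.Nil)
    (hne : p.snd ≠ p.penultimate) (hlt : (p.length : ℕ∞) < 2 * G.egirth) : p.IsCycle := by
  classical
  cases p with
  | nil => simp at hn
  | cons h q =>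
    by_cases hq : q.IsPath
    · have hdrop := (Walk.isPath_iff_nil.1 (hq.dropUntil q.end_mem_support)).eq_nil
      have htake := q.take_spec q.end_mem_support
      rw [hdrop, Walk.append_nil] at htake
      simpa only [htake] using hp.isCycle_cons_takeUntil hq q.end_mem_support
    exfalso
    obtain ⟨x, c, hc, a, b, rfl⟩ := hp.of_cons.exists_isCycle_isSubwalk hq
    have hrest : IsReduced (b.append (.cons h a)) := by
      refine isReduced_append_iff.2 ⟨hp.of_cons.of_append_right, ?_, ?_⟩
      · rw [← Walk.cons_append, ← Walk.cons_append] at hp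
        exact hp.of_append_left.of_append_left
      · by_cases hb : b.Nil
        · exact .inl hb
        · rw [← Walk.cons_append, penultimate_append_of_not_nil _ hb, Walk.cons_append,
            Walk.snd_cons, ← Walk.snd_cons a h] at hne
          exact .inr (.inr hne)
    refine hlt.not_ge ?_
    calc 2 * G.egirth = G.egirth + G.egirth := two_mul _
      _ ≤ c.length + (b.append (.cons h a)).length :=
          add_le_add (SimpleGraph.egirth_le_length hc) (hrest.egirth_le_length (by simp))
      _ = (Walk.cons h ((a.append c).append b)).length := by
          simp only [Walk.length_append, Walk.length_cons]
          push_cast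
          ring

lemma IsReduced.isCycle_iff_snd_ne_penultimate {p : G.Walk v v} (hp : IsReduced p)
    (hn : ¬ p.Nil) (hlt : (p.length : ℕ∞) < 2 * G.egirth) :
    p.IsCycle ↔ p.snd ≠ p.penultimate :=
  ⟨fun h => h.snd_ne_penultimate, fun h => hp.isCycle_of_length_lt hn h hlt⟩

/-! ### Reduction of walks -/

section Reduction

variable [DecidableEq V]

/-- Prepend a step to a walk, cancelling it against the first step of the walk if that step leads
straight back. -/
def cancelCons (h : G.Adj u w) : G.Walk w v → G.Walk u v
  | .nil => .cons h .nil
  | @Walk.cons _ _ _ x _ h' q => if hx : x = u then q.copy hx rfl else .cons h (.cons h' q)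

/-- The reduced walk obtained from a walk by cancelling backtracking steps until none is left; it
plays the role of the lift of the walk to the universal cover. -/
def reduce : {u v : V} → G.Walk u v → G.Walk u v
  | _, _, .nil => .nil
  | _, _, .cons h p => cancelCons h (reduce p)

lemma cancelCons_of_nil_or_snd_ne (h : G.Adj u w) {p : G.Walk w v} (hp : p.Nil ∨ p.snd ≠ u) :
    cancelCons h p = .cons h p := by
  cases p with
  | nil => rfl
  | @cons _ x _ h' q =>
    have : x ≠ u := by simpa using hp
    simp [cancelCons, this]

lemma cancelCons_cons_symm (h : G.Adj u w) (q : G.Walk u v) :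
    cancelCons h (.cons h.symm q) = q := by
  simp [cancelCons]

lemma cancelCons_cases (h : G.Adj u w) (p : G.Walk w v) :
    ((p.Nil ∨ p.snd ≠ u) ∧ cancelCons h p = .cons h p) ∨
      ∃ q : G.Walk u v, p = .cons h.symm q ∧ cancelCons h p = q := by
  by_cases hp : p.Nil ∨ p.snd ≠ u
  · exact .inl ⟨hp, cancelCons_of_nil_or_snd_ne h hp⟩
  · cases p with
    | nil => simp at hp
    | cons h' q =>
      obtain rfl : _ = u := by simpa using hp
      exact .inr ⟨q, rfl, cancelCons_cons_symm h q⟩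

lemma IsReduced.cancelCons (h : G.Adj u w) {p : G.Walk w v} (hp : IsReduced p) :
    IsReduced (cancelCons h p) := by
  obtain ⟨hne, heq⟩ | ⟨q, rfl, heq⟩ := cancelCons_cases h p <;> rw [heq]
  · exact isReduced_cons_iff.2 ⟨hp, hne⟩
  · exact hp.of_cons

lemma isReduced_reduce : ∀ {u v : V} (p : G.Walk u v), IsReduced (reduce p)
  | _, _, .nil => isReduced_nil
  | _, _, .cons h p => (isReduced_reduce p).cancelCons h

lemma IsReduced.cancelCons_symm_cancelCons (h : G.Adj u w) {p : G.Walk w v} (hp : IsReduced p) :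
    ClosedWalk.cancelCons h.symm (ClosedWalk.cancelCons h p) = p := by
  obtain ⟨-, heq⟩ | ⟨q, rfl, heq⟩ := cancelCons_cases h p <;> rw [heq]
  · exact cancelCons_cons_symm h.symm p
  · exact cancelCons_of_nil_or_snd_ne _ (isReduced_cons_iff.1 hp).2

lemma IsReduced.reduce_cons_eq_iff {h : G.Adj u w} {p : G.Walk w v} {r : G.Walk u v}
    (hr : IsReduced r) : reduce (.cons h p) = r ↔ reduce p = ClosedWalk.cancelCons h.symm r := by
  constructor
  · rintro rfl
    exact ((isReduced_reduce p).cancelCons_symm_cancelCons h).symm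
  · intro heq
    rw [reduce, heq]
    exact hr.cancelCons_symm_cancelCons h.symm

lemma IsReduced.reduce_eq : ∀ {u v : V} {p : G.Walk u v}, IsReduced p → reduce p = p
  | _, _, .nil, _ => rfl
  | _, _, .cons h p, hp => by
    rw [reduce, hp.of_cons.reduce_eq]
    exact cancelCons_of_nil_or_snd_ne h (isReduced_cons_iff.1 hp).2

lemma length_reduce_le : ∀ {u v : V} (p : G.Walk u v), (reduce p).length ≤ p.length
  | _, _, .nil => le_rfl
  | _, _, .cons h p => by
    have ih := length_reduce_le p
    rw [reduce, Walk.length_cons]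
    obtain ⟨-, heq⟩ | ⟨q, hq, heq⟩ := cancelCons_cases h (reduce p) <;> rw [heq]
    · simpa using ih
    · rw [hq, Walk.length_cons] at ih
      lia

lemma edges_reduce_subset : ∀ {u v : V} (p : G.Walk u v), (reduce p).edges ⊆ p.edges
  | _, _, .nil => List.Subset.refl _
  | _, _, .cons h p => by
    have ih := edges_reduce_subset p
    rw [reduce, Walk.edges_cons]
    obtain ⟨-, heq⟩ | ⟨q, hq, heq⟩ := cancelCons_cases h (reduce p) <;> rw [heq]
    · exact List.cons_subset_cons _ ih
    · rw [hq, Walk.edges_cons] at ih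
      exact List.subset_cons_of_subset _ (List.subset_of_cons_subset ih)

lemma even_count_edges_reduce_iff (e : Sym2 V) : ∀ {u v : V} (p : G.Walk u v),
    Even ((reduce p).edges.count e) ↔ Even (p.edges.count e)
  | _, _, .nil => Iff.rfl
  | _, _, .cons h p => by
    have ih := even_count_edges_reduce_iff e p
    rw [reduce, Walk.edges_cons]
    obtain ⟨-, heq⟩ | ⟨q, hq, heq⟩ := cancelCons_cases h (reduce p) <;> rw [heq]
    · rw [Walk.edges_cons, List.count_cons, List.count_cons, Nat.even_add, Nat.even_add, ih]
    · rw [hq, Walk.edges_cons, List.count_cons, Sym2.eq_swap, Nat.even_add] at ih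
      rw [List.count_cons, Nat.even_add]
      tauto

lemma nil_reduce_of_isAcyclic {p : G.Walk v v} (h : (fromEdgeSet p.edgeSet).IsAcyclic) :
    (reduce p).Nil := by
  by_contra hn
  obtain ⟨x, c, hc, hcp⟩ := (isReduced_reduce p).exists_isCycle_isSubwalk
    fun hp => hn (Walk.isPath_iff_nil.1 hp)
  refine h _ (hc.transfer fun e he => ?_)
  rw [edgeSet_fromEdgeSet]
  exact ⟨edges_reduce_subset p (hcp.edges_subset he),
    G.not_isDiag_of_mem_edgeSet (c.edges_subset_edgeSet he)⟩

/-- A walk that reduces to the trivial walk uses each of its edges an even number of times, so it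
is at least twice as long as any cycle among its edges. -/
lemma two_mul_egirth_le_length {p : G.Walk v v} (hn : (reduce p).Nil)
    (h : ¬ (fromEdgeSet p.edgeSet).IsAcyclic) : 2 * G.egirth ≤ p.length := by
  have hle : fromEdgeSet p.edgeSet ≤ G := fun a b hab =>
    p.adj_of_mem_edges ((fromEdgeSet_adj _).1 hab).1
  obtain ⟨x, c, hc⟩ : ∃ (x : V) (c : (fromEdgeSet p.edgeSet).Walk x x), c.IsCycle := by
    simpa [IsAcyclic] using h
  have hc' : (c.mapLe hle).IsCycle := (Walk.isCycle_mapLe hle).2 hc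
  have hsub : (c.edges ++ c.edges).Subperm p.edges := by
    refine List.subperm_ext_iff.2 fun e he => ?_
    have hec : e ∈ c.edges := by simpa using he
    have hpos : 0 < p.edges.count e := by
      have := c.edges_subset_edgeSet hec
      rw [edgeSet_fromEdgeSet] at this
      exact List.count_pos_iff.2 this.1
    have heven : Even (p.edges.count e) := by
      simp [← even_count_edges_reduce_iff, hn.eq_nil]
    rw [List.count_append, List.count_eq_one_of_mem hc.edges_nodup hec]
    exact Nat.le_of_dvd hpos heven.two_dvd
  have hlen : 2 * c.length ≤ p.length := by simpa [two_mul] using hsub.length_le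
  calc 2 * G.egirth ≤ 2 * (c.mapLe hle).length := by gcongr; exact SimpleGraph.egirth_le_length hc'
    _ ≤ p.length := by simpa using mod_cast hlen

lemma isAcyclic_fromEdgeSet_edgeSet_iff {p : G.Walk v v}
    (hlt : (p.length : ℕ∞) < 2 * G.egirth) :
    (fromEdgeSet p.edgeSet).IsAcyclic ↔ (reduce p).Nil := by
  refine ⟨nil_reduce_of_isAcyclic, fun hn => ?_⟩
  by_contra h
  exact hlt.not_ge (two_mul_egirth_le_length hn h)

end Reduction

/-! ### Walks with a given reduction -/

section TreeWalkCount

variable {R : Type*} [CommRing R]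

/-- The number of walks of length `n` in a biregular tree between two vertices at distance `l`,
where `a` is the degree of the first vertex and `b` is the degree of its neighbours. -/
def treeWalkCount : R → R → ℕ → ℕ → R
  | _, _, 0, 0 => 1
  | _, _, 0, _ + 1 => 0
  | a, b, n + 1, 0 => a * treeWalkCount b a n 1
  | a, b, n + 1, l + 1 => treeWalkCount b a n l + (a - 1) * treeWalkCount b a n (l + 2)

lemma treeWalkCount_of_lt {n l : ℕ} (h : n < l) (a b : R) : treeWalkCount a b n l = 0 := by
  induction n generalizing l a b with
  | zero =>
    obtain ⟨l, rfl⟩ := Nat.exists_eq_succ_of_ne_zero h.ne'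
    rfl
  | succ n ih =>
    obtain ⟨l, rfl⟩ := Nat.exists_eq_succ_of_ne_zero (Nat.ne_zero_of_lt h)
    rw [treeWalkCount, ih (by lia), ih (by lia), mul_zero, add_zero]

lemma treeWalkCount_self (n : ℕ) (a b : R) : treeWalkCount a b n n = 1 := by
  induction n generalizing a b with
  | zero => rfl
  | succ n ih => rw [treeWalkCount, ih, treeWalkCount_of_lt (by lia), mul_zero, add_zero]

lemma treeWalkCount_add_two (k : ℕ) (a b : R) :
    treeWalkCount a b (2 * k + 2) (2 * k) = a + k * (a + b - 2) := by
  induction k with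
  | zero => simp [treeWalkCount]
  | succ k ih =>
    rw [show 2 * (k + 1) + 2 = 2 * k + 2 + 1 + 1 by ring, show 2 * (k + 1) = 2 * k + 1 + 1 by ring,
      treeWalkCount, treeWalkCount, ih, treeWalkCount_self, treeWalkCount_self]
    push_cast
    ring

lemma treeWalkCount_add_four (k : ℕ) (a b : R) :
    treeWalkCount a b (2 * k + 4) (2 * k) = a * (a + b - 1) +
      k * ((b - 1) * a + (a - 1) * (a + b - 1)) + (k + 1).choose 2 * (a + b - 2) ^ 2 := by
  induction k with
  | zero =>
    simp only [treeWalkCount, Nat.choose_succ_self, Nat.cast_zero]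
    ring
  | succ k ih =>
    have h := treeWalkCount_add_two (k + 1) a b
    rw [show 2 * (k + 1) + 2 = 2 * k + 4 by ring, show 2 * (k + 1) = 2 * k + 2 by ring] at h
    rw [show 2 * (k + 1) + 4 = 2 * k + 4 + 1 + 1 by ring, show 2 * (k + 1) = 2 * k + 1 + 1 by ring,
      treeWalkCount, treeWalkCount, ih, h, treeWalkCount, h, treeWalkCount_self,
      Nat.choose_succ_succ' (k + 1) 1, Nat.choose_one_right]
    push_cast
    ring

end TreeWalkCount

lemma isBiregularWith_symm [G.LocallyFinite] {U W : Set V} {dv dc : ℕ}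
    (hG : G.IsBiregularWith U W dv dc) : G.IsBiregularWith W U dc dv where
  isBipartiteWith := hG.isBipartiteWith.symm
  union_eq_univ := by rw [Set.union_comm, hG.union_eq_univ]
  degree_left := hG.degree_right
  degree_right := hG.degree_left

section CardReduce

variable [DecidableEq V] [G.LocallyFinite] {R : Type*} [CommRing R]

lemma card_filter_finsetWalkLength_succ (n : ℕ) (u v : V) (P : G.Walk u v → Prop)
    [DecidablePred P] : #{p ∈ G.finsetWalkLength (n + 1) u v | P p} =
      ∑ w : G.neighborSet u, #{p ∈ G.finsetWalkLength n w v | P (.cons w.2 p)} := by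
  rw [finsetWalkLength, filter_biUnion, card_biUnion]
  · refine sum_congr rfl fun w _ => ?_
    rw [filter_map, card_map]
    rfl
  · intro w _ w' _ hne
    refine Finset.disjoint_left.2 ?_
    simp only [mem_filter, mem_map]
    rintro p ⟨⟨q, -, rfl⟩, -⟩ ⟨⟨q', -, h⟩, -⟩
    exact hne (Subtype.ext (Walk.cons.inj h).1.symm)

lemma IsReduced.card_filter_reduce_succ_eq {r : G.Walk u v} (hr : IsReduced r) (n : ℕ) :
    #{p ∈ G.finsetWalkLength (n + 1) u v | reduce p = r} =
      ∑ w : G.neighborSet u,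
        #{p ∈ G.finsetWalkLength n w v | reduce p = ClosedWalk.cancelCons (Adj.symm w.2) r} := by
  rw [card_filter_finsetWalkLength_succ]
  exact sum_congr rfl fun w _ => congrArg card (filter_congr fun p _ => hr.reduce_cons_eq_iff)

lemma sum_length_cancelCons_nil (f : ℕ → R) :
    ∑ w : G.neighborSet u, f (cancelCons (Adj.symm w.2) (.nil : G.Walk u u)).length =
      G.degree u * f 1 := by
  simp only [cancelCons, Walk.length_cons, Walk.length_nil, zero_add, sum_const, card_univ,
    card_neighborSet_eq_degree, nsmul_eq_mul]

lemma sum_length_cancelCons_cons (f : ℕ → R) (h : G.Adj u w) (r : G.Walk w v) :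
    ∑ x : G.neighborSet u, f (cancelCons (Adj.symm x.2) (.cons h r)).length =
      f r.length + (G.degree u - 1) * f (r.length + 2) := by
  have hx : ∀ x : G.neighborSet u, f (cancelCons (Adj.symm x.2) (.cons h r)).length =
      f (r.length + 2) + if x = ⟨w, h⟩ then f r.length - f (r.length + 2) else 0 := by
    intro x
    split_ifs with hxw
    · subst hxw
      simp [cancelCons_cons_symm h.symm]
    · have hne : (Walk.cons h r).snd ≠ x := by
        rw [Walk.snd_cons]
        exact fun H => hxw (Subtype.ext H.symm)
      simp [cancelCons_of_nil_or_snd_ne _ (.inr hne)]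
  simp only [hx, sum_add_distrib, sum_const, card_univ, sum_ite_eq', mem_univ, if_true,
    nsmul_eq_mul, card_neighborSet_eq_degree]
  ring

theorem IsReduced.card_filter_reduce_eq {U W : Set V} {dv dc : ℕ}
    (hG : G.IsBiregularWith U W dv dc) (n : ℕ) {u v : V} (hu : u ∈ U) {r : G.Walk u v}
    (hr : IsReduced r) :
    (#{p ∈ G.finsetWalkLength n u v | reduce p = r} : R) =
      treeWalkCount (dv : R) dc n r.length := by
  induction n generalizing U W dv dc u with
  | zero =>
    cases r with
    | nil => simp [finsetWalkLength, reduce, treeWalkCount, filter_singleton]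
    | cons h r =>
      rw [Walk.length_cons, treeWalkCount, card_eq_zero.2, Nat.cast_zero]
      refine filter_eq_empty_iff.2 fun p hp hpr => ?_
      have hlen := length_reduce_le p
      rw [hpr, mem_finsetWalkLength_iff.1 hp] at hlen
      simp at hlen
  | succ n ih =>
    have hsucc (w : G.neighborSet u) := ih (isBiregularWith_symm hG)
      (hG.isBipartiteWith.mem_of_mem_adj hu w.2) (hr.cancelCons (Adj.symm w.2))
    rw [hr.card_filter_reduce_succ_eq, Nat.cast_sum, sum_congr rfl fun w _ => hsucc w,
      ← hG.degree_left u hu]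
    cases r with
    | nil => exact sum_length_cancelCons_nil _
    | cons h r => exact sum_length_cancelCons_cons _ h r

end CardReduce

/-! ### Counting cycles -/

lemma eq_of_isPath_of_edges_subset : ∀ {u v : V} {p q : G.Walk u v}, p.IsPath → q.IsPath →
    q.edges ⊆ p.edges → q = p
  | _, _, .nil, q, _, hq, _ => (Walk.isPath_iff_nil.1 hq).eq_nil
  | u, v, @Walk.cons _ _ _ x _ h p, q, hp, hq, hs => by
    rw [Walk.cons_isPath_iff] at hp
    cases q with
    | nil => exact absurd p.end_mem_support hp.2
    | @cons _ y _ h' q =>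
      rw [Walk.cons_isPath_iff] at hq
      rw [Walk.edges_cons, Walk.edges_cons, List.cons_subset, List.mem_cons] at hs
      obtain rfl : y = x := Sym2.congr_right.1 <|
        hs.1.resolve_right fun hy => hp.2 (p.fst_mem_support_of_mem_edges hy)
      congr 1
      refine eq_of_isPath_of_edges_subset hp.1 hq.1 fun e he => ?_
      refine (List.mem_cons.1 (hs.2 he)).resolve_left ?_
      rintro rfl
      exact hq.2 (q.fst_mem_support_of_mem_edges he)

lemma eq_of_isCycle_of_edgeSet_eq {p q : G.Walk v v} (hp : p.IsCycle) (hq : q.IsCycle)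
    (hs : q.snd = p.snd) (he : q.edgeSet = p.edgeSet) : q = p := by
  cases p with
  | nil => exact absurd hp Walk.not_isCycle_nil
  | cons h p =>
    cases q with
    | nil => exact absurd hq Walk.not_isCycle_nil
    | cons h' q =>
      simp only [Walk.snd_cons] at hs
      subst hs
      rw [Walk.cons_isCycle_iff] at hp hq
      congr 1
      refine eq_of_isPath_of_edges_subset hp.1 hq.1 fun e hmem => ?_
      have hep : e ∈ (Walk.cons h p).edgeSet := he ▸ List.mem_cons_of_mem _ hmem
      refine (List.mem_cons.1 hep).resolve_left ?_
      rintro rfl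
      exact hq.2 hmem

lemma exists_isCycle_snd_eq_of_mem_edges {a b : V} {c : G.Walk v v} (hc : c.IsCycle)
    (he : s(a, b) ∈ c.edges) : ∃ c' : G.Walk a a,
      c'.IsCycle ∧ c'.snd = b ∧ c'.length = c.length ∧ c'.edgeSet = c.edgeSet := by
  classical
  have ha := c.fst_mem_support_of_mem_edges he
  have hr := (Walk.isCycle_rotate ha).2 hc
  have hE : (c.rotate a ha).edgeSet = c.edgeSet := by
    ext e
    exact (c.rotate_edges a ha).mem_iff
  have hb : b ∈ (c.rotate a ha).toSubgraph.neighborSet a := by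
    rw [Subgraph.mem_neighborSet, ← Subgraph.mem_edgeSet, Walk.mem_edges_toSubgraph]
    exact (c.rotate_edges a ha).mem_iff.2 he
  rw [hr.neighborSet_toSubgraph_endpoint] at hb
  obtain hb | hb := hb
  · exact ⟨_, hr, hb.symm, by simp, hE⟩
  · exact ⟨_, hr.reverse, by rw [Walk.snd_reverse, hb], by simp, by rw [Walk.edgeSet_reverse, hE]⟩

lemma exists_isCycle_mk_snd_eq_of_isBipartiteWith {U W : Set V} (hG : G.IsBipartiteWith U W)
    {c : G.Walk v v} (hc : c.IsCycle) {e : Sym2 V} (he : e ∈ c.edges) :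
    ∃ a ∈ U, ∃ c' : G.Walk a a,
      c'.IsCycle ∧ s(a, c'.snd) = e ∧ c'.length = c.length ∧ c'.edgeSet = c.edgeSet := by
  induction e with
  | _ a b =>
    obtain ⟨ha, -⟩ | ⟨-, hb⟩ := hG.mem_of_adj (c.adj_of_mem_edges he)
    · obtain ⟨c', h, rfl, hE⟩ := exists_isCycle_snd_eq_of_mem_edges hc he
      exact ⟨a, ha, c', h, rfl, hE⟩
    · obtain ⟨c', h, rfl, hE⟩ := exists_isCycle_snd_eq_of_mem_edges hc (Sym2.eq_swap ▸ he)
      exact ⟨b, hb, c', h, Sym2.eq_swap, hE⟩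

section CountCycles

variable [DecidableEq V] [G.LocallyFinite]

open scoped Classical in
variable (G) in
/-- The cycles of length `n` that start and end at `v`, counted with direction. -/
noncomputable def cyclesAt (n : ℕ) (v : V) : Finset (G.Walk v v) :=
  {p ∈ G.finsetWalkLength n v v | p.IsCycle}

lemma mem_cyclesAt {n : ℕ} {p : G.Walk v v} : p ∈ cyclesAt G n v ↔ p.length = n ∧ p.IsCycle := by
  simp [cyclesAt, mem_finsetWalkLength_iff]

lemma mem_sigma_cyclesAt {n : ℕ} {U : Finset V} {x : Σ v, G.Walk v v} :
    x ∈ U.sigma (cyclesAt G n) ↔ x.1 ∈ U ∧ x.2.length = n ∧ x.2.IsCycle := by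
  rw [mem_sigma, mem_cyclesAt]

variable {U W : Finset V}

/-- Each edge of a cycle is the first edge of exactly one of its orientations that start in `U`. -/
lemma card_filter_edges_toFinset_eq (hG : G.IsBipartiteWith U W) {c : G.Walk v v}
    (hc : c.IsCycle) :
    #{x ∈ U.sigma (cyclesAt G c.length) | x.2.edges.toFinset = c.edges.toFinset} = c.length := by
  have hcard : #c.edges.toFinset = c.length := by
    rw [List.toFinset_card_of_nodup hc.edges_nodup, Walk.length_edges]
  refine (card_bij (fun x _ => s(x.1, x.2.snd)) ?_ ?_ ?_).trans hcard
  · rintro ⟨a, p⟩ hp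
    rw [mem_filter, mem_sigma_cyclesAt] at hp
    rw [← hp.2, List.mem_toFinset]
    exact Walk.mk_start_snd_mem_edges hp.1.2.2.not_nil
  · rintro ⟨a, p⟩ hp ⟨b, q⟩ hq h
    simp only [mem_filter, mem_sigma_cyclesAt, ← coe_inj, Walk.coe_edges_toFinset] at hp hq
    obtain ⟨rfl, hsnd⟩ | ⟨rfl, -⟩ := Sym2.eq_iff.1 h
    · rw [eq_of_isCycle_of_edgeSet_eq hq.1.2.2 hp.1.2.2 hsnd (hp.2.trans hq.2.symm)]
    · exact (Set.disjoint_left.1 hG.disjoint hp.1.1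
        (hG.mem_of_mem_adj hq.1.1 (Walk.adj_snd hq.1.2.2.not_nil))).elim
  · intro e he
    obtain ⟨a, ha, p, hp, rfl, hlen, hE⟩ :=
      exists_isCycle_mk_snd_eq_of_isBipartiteWith hG hc (List.mem_toFinset.1 he)
    refine ⟨⟨a, p⟩, ?_, rfl⟩
    simp only [mem_filter, mem_sigma_cyclesAt, ← coe_inj, Walk.coe_edges_toFinset]
    exact ⟨⟨ha, hlen, hp⟩, hE⟩

lemma card_image_edges_toFinset (hG : G.IsBipartiteWith U W) (n : ℕ) :
    #((U.sigma (cyclesAt G n)).image fun x => x.2.edges.toFinset) = G.numCycles n := by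
  rw [numCycles, ← Set.ncard_coe_finset, ← Set.ncard_image_of_injective _ coe_injective]
  congr 1
  ext E
  simp only [Set.mem_image, mem_coe, Finset.mem_image, Set.mem_ofPred_eq]
  constructor
  · rintro ⟨_, ⟨⟨v, c⟩, hc, rfl⟩, rfl⟩
    rw [mem_sigma_cyclesAt] at hc
    exact ⟨v, c, hc.2.2, hc.2.1, Walk.coe_edges_toFinset c⟩
  · rintro ⟨v, c, hc, rfl, rfl⟩
    obtain ⟨a, ha, p, hp, -, hlen, hE⟩ :=
      exists_isCycle_mk_snd_eq_of_isBipartiteWith hG hc (Walk.mk_start_snd_mem_edges hc.not_nil)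
    exact ⟨_, ⟨⟨a, p⟩, mem_sigma_cyclesAt.2 ⟨ha, hlen, hp⟩, rfl⟩,
      (Walk.coe_edges_toFinset p).trans hE⟩

theorem sum_card_cyclesAt (hG : G.IsBipartiteWith U W) (n : ℕ) :
    ∑ v ∈ U, #(cyclesAt G n v) = n * G.numCycles n := by
  rw [← card_sigma, card_eq_sum_card_image fun x => x.2.edges.toFinset,
    ← card_image_edges_toFinset hG, mul_comm, ← smul_eq_mul, ← sum_const]
  refine sum_congr rfl fun E hE => ?_
  obtain ⟨⟨v, c⟩, hc, rfl⟩ := Finset.mem_image.1 hE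
  rw [mem_sigma_cyclesAt] at hc
  obtain ⟨-, rfl, hc⟩ := hc
  exact card_filter_edges_toFinset_eq hG hc

end CountCycles

/-! ### Counting reduced closed walks -/

lemma exists_eq_cons_concat {p : G.Walk v v} (hn : ¬ p.Nil) (hsnd : p.snd = p.penultimate) :
    ∃ (w : V) (h : G.Adj v w) (q : G.Walk w w), p = .cons h (q.concat h.symm) := by
  cases p with
  | nil => simp at hn
  | @cons _ w _ h p =>
    have hp : ¬ p.Nil := fun hp => h.ne hp.eq.symm
    rw [Walk.snd_cons, Walk.penultimate_cons_of_not_nil _ _ hp] at hsnd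
    have hconcat : ∀ {x : V} (hx : G.Adj x v), x = p.penultimate →
        ∃ q : G.Walk w x, p = q.concat hx := by
      rintro _ hx rfl
      exact ⟨p.dropLast, (Walk.concat_dropLast hx).symm⟩
    obtain ⟨q, rfl⟩ := hconcat h.symm hsnd
    exact ⟨w, h, q, rfl⟩

lemma sum_sum_neighborFinset_comm [G.LocallyFinite] {M : Type*} [AddCommMonoid M] {U W : Finset V}
    (hG : G.IsBipartiteWith U W) (f : V → V → M) :
    ∑ v ∈ U, ∑ w ∈ G.neighborFinset v, f v w = ∑ w ∈ W, ∑ v ∈ G.neighborFinset w, f v w := by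
  refine sum_comm' fun v w => ?_
  rw [mem_neighborFinset, mem_neighborFinset, G.adj_comm w v]
  exact ⟨fun h => ⟨h.2, hG.mem_of_mem_adj h.1 h.2⟩, fun h => ⟨hG.mem_of_mem_adj' h.2 h.1, h.1⟩⟩

section CountReduced

variable [DecidableEq V] [G.LocallyFinite] {R : Type*} [CommRing R]

open scoped Classical in
variable (G) in
/-- The reduced closed walks of length `n` that start and end at `v`. -/
noncomputable def reducedClosedWalks (n : ℕ) (v : V) : Finset (G.Walk v v) :=
  {p ∈ G.finsetWalkLength n v v | IsReduced p}

variable (G) in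
/-- The number of reduced closed walks of length `n` that start in `U`. -/
noncomputable def numReducedClosedFrom (U : Finset V) (n : ℕ) : ℕ :=
  ∑ v ∈ U, #(reducedClosedWalks G n v)

lemma mem_reducedClosedWalks {n : ℕ} {p : G.Walk v v} :
    p ∈ reducedClosedWalks G n v ↔ p.length = n ∧ IsReduced p := by
  simp [reducedClosedWalks, mem_finsetWalkLength_iff]

lemma not_nil_of_mem_reducedClosedWalks {n : ℕ} (hn : 0 < n) {p : G.Walk v v}
    (hp : p ∈ reducedClosedWalks G n v) : ¬ p.Nil := by
  rw [← Walk.length_eq_zero_iff, (mem_reducedClosedWalks.1 hp).1]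
  exact hn.ne'

lemma card_filter_length_reduce_eq {U W : Set V} {dv dc : ℕ}
    (hG : G.IsBiregularWith U W dv dc) (n l : ℕ) (hv : v ∈ U) :
    (#{p ∈ G.finsetWalkLength n v v | (reduce p).length = l} : R) =
      treeWalkCount (dv : R) dc n l * #(reducedClosedWalks G l v) := by
  have hfiber : ∀ r ∈ reducedClosedWalks G l v,
      (#{p ∈ {p ∈ G.finsetWalkLength n v v | (reduce p).length = l} | reduce p = r} : R) =
        treeWalkCount (dv : R) dc n l := by
    intro r hr
    obtain ⟨hlen, hr⟩ := mem_reducedClosedWalks.1 hr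
    rw [← hlen, ← hr.card_filter_reduce_eq hG n hv, filter_filter]
    exact congrArg (fun s : Finset _ => (#s : R)) (filter_congr fun p _ => by grind)
  rw [card_eq_sum_card_fiberwise (f := reduce) (t := reducedClosedWalks G l v), Nat.cast_sum,
    sum_congr rfl hfiber, sum_const, nsmul_eq_mul, mul_comm]
  intro p hp
  exact mem_reducedClosedWalks.2 ⟨(mem_filter.1 hp).2, isReduced_reduce p⟩

lemma filter_isCycle_reducedClosedWalks [DecidablePred fun p : G.Walk v v => p.IsCycle] (n : ℕ) :
    {p ∈ reducedClosedWalks G n v | p.IsCycle} = cyclesAt G n v := by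
  ext p
  rw [mem_filter, mem_reducedClosedWalks, mem_cyclesAt]
  exact ⟨fun h => ⟨h.1.1, h.2⟩, fun h => ⟨⟨h.1, isReduced_of_isCycle h.2⟩, h.2⟩⟩

lemma card_reducedClosedWalks_eq_add {n : ℕ} (hn : 0 < n) (hlt : (n : ℕ∞) < 2 * G.egirth) (v : V) :
    #(reducedClosedWalks G n v) =
      #(cyclesAt G n v) + #{p ∈ reducedClosedWalks G n v | p.snd = p.penultimate} := by
  classical
  have hcycle : {p ∈ reducedClosedWalks G n v | ¬ p.snd = p.penultimate} = cyclesAt G n v := by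
    rw [← filter_isCycle_reducedClosedWalks]
    refine filter_congr fun p hp => ?_
    obtain ⟨hlen, hr⟩ := mem_reducedClosedWalks.1 hp
    exact (hr.isCycle_iff_snd_ne_penultimate (not_nil_of_mem_reducedClosedWalks hn hp)
      (hlen ▸ hlt)).symm
  rw [← hcycle, add_comm, card_filter_add_card_filter_not]

lemma card_filter_snd_eq_penultimate {n : ℕ} (hn : 0 < n) (v : V) :
    #{p ∈ reducedClosedWalks G (n + 2) v | p.snd = p.penultimate} =
      ∑ w ∈ G.neighborFinset v,
        #{q ∈ reducedClosedWalks G n w | v ≠ q.snd ∧ v ≠ q.penultimate} := by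
  rw [← sum_attach, ← card_sigma]
  symm
  refine card_bij (fun x _ => .cons ((G.mem_neighborFinset _ _).1 x.1.2)
    (x.2.concat ((G.mem_neighborFinset _ _).1 x.1.2).symm)) ?_ ?_ ?_
  · rintro ⟨⟨w, hw⟩, q⟩ hq
    simp only [mem_sigma, mem_filter] at hq
    obtain ⟨-, hq, hsnd⟩ := hq
    obtain ⟨hlen, hr⟩ := mem_reducedClosedWalks.1 hq
    have hnil := not_nil_of_mem_reducedClosedWalks hn hq
    rw [mem_filter, mem_reducedClosedWalks, isReduced_cons_concat_iff hnil]
    refine ⟨⟨by simp [hlen], hr, hsnd⟩, ?_⟩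
    rw [Walk.snd_cons, Walk.penultimate_cons_of_not_nil, Walk.penultimate_concat]
    simp [← Walk.length_eq_zero_iff]
  · rintro ⟨⟨w, hw⟩, q⟩ - ⟨⟨w', hw'⟩, q'⟩ - h
    obtain rfl : w = w' := by simpa using congrArg Walk.snd h
    simp only [Walk.cons.injEq, heq_eq_eq, true_and] at h
    obtain ⟨_, hqq'⟩ := Walk.concat_inj h
    rw [Walk.copy_rfl_rfl] at hqq'
    rw [hqq']
  · intro p hp
    obtain ⟨hp, hsnd⟩ := mem_filter.1 hp
    obtain ⟨hlen, hr⟩ := mem_reducedClosedWalks.1 hp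
    obtain ⟨w, h, q, rfl⟩ := exists_eq_cons_concat
      (not_nil_of_mem_reducedClosedWalks (by lia) hp) hsnd
    have hq : q.length = n := by simpa using hlen
    have hnil : ¬ q.Nil := by
      rw [← Walk.length_eq_zero_iff, hq]
      exact hn.ne'
    refine ⟨⟨⟨w, (G.mem_neighborFinset _ _).2 h⟩, q⟩, ?_, rfl⟩
    rw [isReduced_cons_concat_iff hnil] at hr
    simp only [mem_sigma, mem_attach, mem_filter, mem_reducedClosedWalks, true_and]
    exact ⟨⟨hq, hr.1⟩, hr.2⟩

lemma card_filter_neighborFinset_ne_ne {a b : V} (ha : G.Adj w a) (hb : G.Adj w b) :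
    (#{v ∈ G.neighborFinset w | v ≠ a ∧ v ≠ b} : R) = G.degree w - 1 - if a ≠ b then 1 else 0 := by
  have herase :
      {v ∈ G.neighborFinset w | v ≠ a ∧ v ≠ b} = ((G.neighborFinset w).erase a).erase b := by
    ext v
    simp only [mem_filter, mem_erase]
    tauto
  have ha' : a ∈ G.neighborFinset w := (G.mem_neighborFinset _ _).2 ha
  rw [herase]
  split_ifs with hab
  · rw [cast_card_erase_of_mem (mem_erase.2 ⟨hab.symm, (G.mem_neighborFinset _ _).2 hb⟩),
      cast_card_erase_of_mem ha', card_neighborFinset_eq_degree]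
  · rw [not_not.1 hab, erase_idem, cast_card_erase_of_mem ((G.mem_neighborFinset _ _).2 hb),
      card_neighborFinset_eq_degree, sub_zero]

/-- Counting the other way round: two neighbours are excluded for a cycle `q`, but only one for any
other `q`, since then `q.snd = q.penultimate`. -/
lemma sum_card_filter_ne_ne {n : ℕ} (hn : 0 < n) (hlt : (n : ℕ∞) < 2 * G.egirth) (w : V) :
    ∑ v ∈ G.neighborFinset w,
        (#{q ∈ reducedClosedWalks G n w | v ≠ q.snd ∧ v ≠ q.penultimate} : R) =
      (G.degree w - 1) * #(reducedClosedWalks G n w) - #(cyclesAt G n w) := by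
  classical
  have hq : ∀ q ∈ reducedClosedWalks G n w,
      (#{v ∈ G.neighborFinset w | v ≠ q.snd ∧ v ≠ q.penultimate} : R) =
        (G.degree w - 1) - if q.IsCycle then 1 else 0 := by
    intro q hq
    obtain ⟨hlen, hr⟩ := mem_reducedClosedWalks.1 hq
    have hnil := not_nil_of_mem_reducedClosedWalks hn hq
    rw [card_filter_neighborFinset_ne_ne (Walk.adj_snd hnil) (Walk.adj_penultimate hnil).symm]
    simp only [hr.isCycle_iff_snd_ne_penultimate hnil (hlen ▸ hlt)]
  have hcomm := sum_card_bipartiteAbove_eq_sum_card_bipartiteBelow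
    (s := G.neighborFinset w) (t := reducedClosedWalks G n w)
    (fun v q => v ≠ q.snd ∧ v ≠ q.penultimate)
  simp only [bipartiteAbove, bipartiteBelow] at hcomm
  rw [← Nat.cast_sum, hcomm, Nat.cast_sum, sum_congr rfl hq, sum_sub_distrib, sum_const,
    nsmul_eq_mul, sum_boole, filter_isCycle_reducedClosedWalks, mul_comm]

theorem numReducedClosedFrom_add_two {U W : Finset V} {d : ℕ} (hG : G.IsBipartiteWith U W)
    (hW : ∀ w ∈ W, G.degree w = d) {n : ℕ} (hn : 0 < n)
    (hlt : ((n + 2 : ℕ) : ℕ∞) < 2 * G.egirth) :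
    (numReducedClosedFrom G U (n + 2) : R) = (n + 2) * G.numCycles (n + 2) +
      (d - 1) * numReducedClosedFrom G W n - n * G.numCycles n := by
  have hlt' : (n : ℕ∞) < 2 * G.egirth := lt_of_le_of_lt (mod_cast n.le_add_right 2) hlt
  have htail : ∑ v ∈ U, (#{p ∈ reducedClosedWalks G (n + 2) v | p.snd = p.penultimate} : R) =
      (d - 1) * numReducedClosedFrom G W n - n * G.numCycles n := by
    simp_rw [card_filter_snd_eq_penultimate hn, Nat.cast_sum]
    rw [sum_sum_neighborFinset_comm hG, sum_congr rfl fun w _ => sum_card_filter_ne_ne hn hlt' w,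
      sum_congr rfl fun w hw => by rw [hW w hw], sum_sub_distrib, ← mul_sum, numReducedClosedFrom,
      ← Nat.cast_mul, ← sum_card_cyclesAt hG.symm n]
    push_cast
    rfl
  have hcycles : ∑ v ∈ U, (#(cyclesAt G (n + 2) v) : R) = (n + 2) * G.numCycles (n + 2) := by
    rw [← Nat.cast_sum, sum_card_cyclesAt hG]
    push_cast
    rfl
  rw [add_sub_assoc, ← htail, ← hcycles, ← sum_add_distrib, numReducedClosedFrom, Nat.cast_sum]
  refine sum_congr rfl fun v _ => ?_
  rw [card_reducedClosedWalks_eq_add (by lia) hlt v, Nat.cast_add]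

lemma numReducedClosedFrom_eq_zero_of_lt_egirth (U : Finset V) {n : ℕ} (hn : 0 < n)
    (hlt : (n : ℕ∞) < G.egirth) : numReducedClosedFrom G U n = 0 := by
  refine sum_eq_zero fun v _ => card_eq_zero.2 (eq_empty_of_forall_notMem fun p hp => ?_)
  obtain ⟨rfl, hr⟩ := mem_reducedClosedWalks.1 hp
  exact hlt.not_ge (hr.egirth_le_length (not_nil_of_mem_reducedClosedWalks hn hp))

lemma numReducedClosedFrom_eq_zero_of_odd (hG : G.IsBipartite) (U : Finset V) {n : ℕ}
    (hn : Odd n) : numReducedClosedFrom G U n = 0 := by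
  refine sum_eq_zero fun v _ => card_eq_zero.2 (eq_empty_of_forall_notMem fun p hp => ?_)
  obtain ⟨rfl, -⟩ := mem_reducedClosedWalks.1 hp
  exact Nat.not_even_iff_odd.2 hn (two_colorable_iff_forall_loop_even.1 hG v p)

end CountReduced

lemma numCycles_eq_zero_of_lt_egirth {n : ℕ} (hlt : (n : ℕ∞) < G.egirth) : G.numCycles n = 0 := by
  refine (congrArg Set.ncard (Set.eq_empty_of_forall_notMem ?_)).trans (Set.ncard_empty _)
  rintro _ ⟨v, c, hc, rfl, -⟩
  exact hlt.not_ge (SimpleGraph.egirth_le_length hc)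

lemma even_of_egirth_eq (hG : G.IsBipartite) {g : ℕ} (hg : G.egirth = g) : Even g := by
  have hcyc : ¬ G.IsAcyclic := fun h => by simp [h.egirth_eq_top] at hg
  obtain ⟨v, c, -, hc⟩ := SimpleGraph.exists_egirth_eq_length.2 hcyc
  rw [hg, Nat.cast_inj] at hc
  exact hc ▸ two_colorable_iff_forall_loop_even.1 hG v c

section Girth

variable [DecidableEq V] [G.LocallyFinite] {R : Type*} [CommRing R] {U W : Finset V} {dv dc g : ℕ}

lemma numReducedClosedFrom_girth (hG : G.IsBiregularWith U W dv dc) (hg : G.egirth = g) :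
    (numReducedClosedFrom G U g : R) = g * G.numCycles g := by
  have h3 : 3 ≤ g := by exact_mod_cast hg ▸ G.three_le_egirth
  obtain ⟨n, rfl⟩ := Nat.exists_eq_add_of_le' h3
  have hn : ((n + 1 : ℕ) : ℕ∞) < G.egirth := by
    rw [hg]
    exact_mod_cast (by lia : n + 1 < n + 3)
  have hlt : ((n + 1 + 2 : ℕ) : ℕ∞) < 2 * G.egirth := by
    rw [hg]
    exact_mod_cast (by lia : n + 1 + 2 < 2 * (n + 3))
  rw [numReducedClosedFrom_add_two hG.isBipartiteWith hG.degree_right n.succ_pos hlt,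
    numReducedClosedFrom_eq_zero_of_lt_egirth W n.succ_pos hn, numCycles_eq_zero_of_lt_egirth hn]
  push_cast
  ring

lemma numReducedClosedFrom_girth_add_two (hG : G.IsBiregularWith U W dv dc) (hg : G.egirth = g) :
    (numReducedClosedFrom G U (g + 2) : R) =
      (g + 2) * G.numCycles (g + 2) + (dc - 2) * (g * G.numCycles g) := by
  have h3 : 3 ≤ g := by exact_mod_cast hg ▸ G.three_le_egirth
  have hlt : ((g + 2 : ℕ) : ℕ∞) < 2 * G.egirth := by
    rw [hg]
    exact_mod_cast (by lia : g + 2 < 2 * g)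
  rw [numReducedClosedFrom_add_two hG.isBipartiteWith hG.degree_right (by lia) hlt,
    numReducedClosedFrom_girth (isBiregularWith_symm hG) hg]
  ring

lemma numReducedClosedFrom_girth_add_four (hG : G.IsBiregularWith U W dv dc) (hg : G.egirth = g)
    (h4 : 4 < g) :
    (numReducedClosedFrom G U (g + 4) : R) =
      (g + 4) * G.numCycles (g + 4) + (dc - 2) * ((g + 2) * G.numCycles (g + 2)) +
        (dc - 1) * (dv - 2) * (g * G.numCycles g) := by
  have hlt : ((g + 2 + 2 : ℕ) : ℕ∞) < 2 * G.egirth := by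
    rw [hg]
    exact_mod_cast (by lia : g + 2 + 2 < 2 * g)
  rw [numReducedClosedFrom_add_two hG.isBipartiteWith hG.degree_right (by lia) hlt,
    numReducedClosedFrom_girth_add_two (isBiregularWith_symm hG) hg]
  push_cast
  ring

end Girth

/-! ### Closed walks with cycle -/

section ClosedWalksWithCycle

variable [DecidableEq V] [G.LocallyFinite]

open scoped Classical in
variable (G) in
/-- The closed walks with cycle of length `n` that start and end at `v`. -/
noncomputable def closedWalksWithCycle (n : ℕ) (v : V) : Finset (G.Walk v v) :=
  {p ∈ G.finsetWalkLength n v v | p.IsClosedWalkWithCycle}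

lemma mem_closedWalksWithCycle {n : ℕ} {p : G.Walk v v} :
    p ∈ closedWalksWithCycle G n v ↔ p.length = n ∧ p.IsClosedWalkWithCycle := by
  simp [closedWalksWithCycle, mem_finsetWalkLength_iff]

lemma card_closedWalksWithCycle_add_card_cyclesAt {n : ℕ} (hlt : (n : ℕ∞) < 2 * G.egirth) (v : V) :
    #(closedWalksWithCycle G n v) + #(cyclesAt G n v) =
      #{p ∈ G.finsetWalkLength n v v | ¬ (reduce p).Nil} := by
  classical
  rw [← card_union_of_disjoint]
  · congr 1
    ext p
    simp only [mem_union, mem_closedWalksWithCycle, mem_cyclesAt, mem_filter,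
      mem_finsetWalkLength_iff, Walk.IsClosedWalkWithCycle]
    have hcycle : p.IsCycle → ¬ (reduce p).Nil := fun hp => by
      rw [(isReduced_of_isCycle hp).reduce_eq]
      exact hp.not_nil
    by_cases hp : p.length = n
    · rw [isAcyclic_fromEdgeSet_edgeSet_iff (hp ▸ hlt)]
      tauto
    · tauto
  · refine Finset.disjoint_left.2 fun p hp hcycle => ?_
    exact (mem_closedWalksWithCycle.1 hp).2.1 (mem_cyclesAt.1 hcycle).2

lemma card_filter_not_nil_reduce (n : ℕ) (v : V) :
    #{p ∈ G.finsetWalkLength n v v | ¬ (reduce p).Nil} =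
      ∑ l ∈ Icc 1 n, #{p ∈ G.finsetWalkLength n v v | (reduce p).length = l} := by
  have hmem : ∀ p ∈ ({p ∈ G.finsetWalkLength n v v | ¬ (reduce p).Nil} : Finset (G.Walk v v)),
      (reduce p).length ∈ Icc 1 n := by
    intro p hp
    rw [mem_filter, mem_finsetWalkLength_iff, ← Walk.length_eq_zero_iff] at hp
    rw [mem_Icc, ← hp.1]
    exact ⟨Nat.one_le_iff_ne_zero.2 hp.2, length_reduce_le p⟩
  rw [card_eq_sum_card_fiberwise hmem]
  refine sum_congr rfl fun l hl => ?_
  rw [filter_filter]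
  refine congrArg card (filter_congr fun p _ => ?_)
  rw [← Walk.length_eq_zero_iff]
  have := (mem_Icc.1 hl).1
  lia

variable {R : Type*} [CommRing R] {U W : Finset V} {dv dc : ℕ}

theorem sum_card_closedWalksWithCycle (hG : G.IsBiregularWith U W dv dc) {n : ℕ}
    (hlt : (n : ℕ∞) < 2 * G.egirth) :
    (∑ v ∈ U, #(closedWalksWithCycle G n v) : R) =
      ∑ l ∈ Icc 1 n, treeWalkCount (dv : R) dc n l * numReducedClosedFrom G U l -
        n * G.numCycles n := by
  have hvertex : ∀ v ∈ U, (#(closedWalksWithCycle G n v) + #(cyclesAt G n v) : R) =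
      ∑ l ∈ Icc 1 n, treeWalkCount (dv : R) dc n l * #(reducedClosedWalks G l v) := by
    intro v hv
    rw [← Nat.cast_add, card_closedWalksWithCycle_add_card_cyclesAt hlt, card_filter_not_nil_reduce,
      Nat.cast_sum]
    exact sum_congr rfl fun l _ => card_filter_length_reduce_eq hG n l hv
  rw [eq_sub_iff_add_eq, ← Nat.cast_mul, ← sum_card_cyclesAt hG.isBipartiteWith, Nat.cast_sum,
    ← sum_add_distrib, sum_congr rfl hvertex, sum_comm]
  simp only [numReducedClosedFrom, Nat.cast_sum, mul_sum]

lemma sum_card_closedWalksWithCycle_girth_add_four {g : ℕ} (hG : G.IsBiregularWith U W dv dc)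
    (hg : G.egirth = g) (h4 : 4 < g) :
    (∑ v ∈ U, #(closedWalksWithCycle G (g + 4) v) : R) =
      (treeWalkCount (dv : R) dc (g + 4) g + (dc - 2) * treeWalkCount (dv : R) dc (g + 4) (g + 2) +
        (dc - 1) * (dv - 2)) * (g * G.numCycles g) +
      (treeWalkCount (dv : R) dc (g + 4) (g + 2) + (dc - 2)) *
        ((g + 2) * G.numCycles (g + 2)) := by
  have hlt : ((g + 4 : ℕ) : ℕ∞) < 2 * G.egirth := by
    rw [hg]
    exact_mod_cast (by lia : g + 4 < 2 * g)
  have hbip := hG.isBipartiteWith.isBipartite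
  have heven := even_of_egirth_eq hbip hg
  have hsub : ({g, g + 2, g + 4} : Finset ℕ) ⊆ Icc 1 (g + 4) := by
    intro l hl
    simp only [mem_insert, mem_singleton] at hl
    exact mem_Icc.2 (by lia)
  rw [sum_card_closedWalksWithCycle hG hlt, ← sum_subset hsub]
  · rw [sum_insert (by simp), sum_insert (by simp), sum_singleton, treeWalkCount_self,
      numReducedClosedFrom_girth hG hg, numReducedClosedFrom_girth_add_two hG hg,
      numReducedClosedFrom_girth_add_four hG hg h4]
    push_cast
    ring
  · intro l hl hne
    rw [mem_Icc] at hl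
    simp only [mem_insert, mem_singleton] at hne
    have hzero : numReducedClosedFrom G U l = 0 := by
      obtain hlg | hgl := lt_or_ge l g
      · exact numReducedClosedFrom_eq_zero_of_lt_egirth U hl.1 (hg ▸ mod_cast hlg)
      · exact numReducedClosedFrom_eq_zero_of_odd hbip U (by grind)
    rw [hzero, Nat.cast_zero, mul_zero]

lemma numClosedWalksWithCycle_eq_add (hG : G.IsBiregularWith U W dv dc) (n : ℕ) :
    G.numClosedWalksWithCycle n =
      ∑ v ∈ U, #(closedWalksWithCycle G n v) + ∑ v ∈ W, #(closedWalksWithCycle G n v) := by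
  rw [← sum_union (disjoint_coe.1 hG.isBipartiteWith.disjoint), ← card_sigma,
    ← Set.ncard_coe_finset, numClosedWalksWithCycle]
  congr 1
  ext x
  have hx : x.1 ∈ U ∪ W := by
    rw [← mem_coe, coe_union, hG.union_eq_univ]
    exact Set.mem_univ _
  rw [mem_coe, mem_sigma, mem_closedWalksWithCycle]
  exact (and_iff_right hx).symm

end ClosedWalksWithCycle

end ClosedWalk

/-- The girth `g` is finite, so `G` has a cycle; it is even because `G` is bipartite, so the
natural-number quotient `g / 2` inside the binomial coefficient is exact. -/
theorem theorem3 {V : Type*} [Fintype V] (G : SimpleGraph V) [DecidableRel G.Adj]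
    (U W : Set V) (dv dc g : ℕ) (hG : G.IsBiregularWith U W dv dc)
    (hgirth : G.egirth = (g : ℕ∞)) (hg : 6 ≤ g) :
    (G.numClosedWalksWithCycle (g + 4) : ℚ) / (2 * ((g : ℚ) + 4)) =
      (G.numCycles (g + 2) : ℚ) * (((g : ℚ) + 2) / 2 * ((dv : ℚ) + dc) - ((g : ℚ) + 2))
      + (G.numCycles g : ℚ) *
          ((g : ℚ) / 2 * ((dv : ℚ) - 2) * ((dc : ℚ) - 1)
            + (g : ℚ) / 2 * ((dc : ℚ) - 2) * ((dv : ℚ) - 1))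
      + (G.numCycles g : ℚ) *
          ((((g / 2).choose 2 : ℚ) + (g : ℚ) / 2) * ((dv : ℚ) - 2) ^ 2
            + (((g / 2).choose 2 : ℚ) + (g : ℚ) / 2) * ((dc : ℚ) - 2) ^ 2
            + ((g : ℚ) / 2) ^ 2 * ((dv : ℚ) - 2) * ((dc : ℚ) - 2))
      + (G.numCycles g : ℚ) *
          ((g.choose 2 : ℚ) + 2 * (g : ℚ)
            + ((g : ℚ) + 2) * ((g : ℚ) / 2 * ((dv : ℚ) - 2) + (g : ℚ) / 2 * ((dc : ℚ) - 2))) := by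
  classical
  lift U to Finset V using U.toFinite
  lift W to Finset V using W.toFinite
  obtain ⟨k, rfl⟩ := (ClosedWalk.even_of_egirth_eq hG.isBipartiteWith.isBipartite hgirth).two_dvd
  have htree (a b : ℚ) : ClosedWalk.treeWalkCount a b (2 * k + 4) (2 * k + 2) =
      a + (k + 1) * (a + b - 2) := by
    simpa [mul_add] using ClosedWalk.treeWalkCount_add_two (k + 1) a b
  rw [div_eq_iff (by positivity), ClosedWalk.numClosedWalksWithCycle_eq_add hG, Nat.cast_add,
    Nat.cast_sum, Nat.cast_sum,
    ClosedWalk.sum_card_closedWalksWithCycle_girth_add_four hG hgirth (by lia),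
    ClosedWalk.sum_card_closedWalksWithCycle_girth_add_four (ClosedWalk.isBiregularWith_symm hG)
      hgirth (by lia),
    htree, htree, ClosedWalk.treeWalkCount_add_four, ClosedWalk.treeWalkCount_add_four,
    Nat.mul_div_cancel_left k two_pos, Nat.cast_choose_two, Nat.cast_choose_two,
    Nat.cast_choose_two]
  push_cast
  ring
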